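/- Let $I$ be a non-empty finite set and let $\{\alpha_i\mid i\in I\}$ be the standard basis of $\mathbb{Z}^I$. A \emph{generalized Cartan matrix} is a matrix $C=(c_{ij})\in\mathbb{Z}^{I\times I}$ with $c_{ii}=2$ for all $i$, $c_{jk}\le 0$ for all $j\ne k$, and such that $c_{ij}=0$ implies $c_{ji}=0$. A \emph{Cartan scheme} $\mathcal{C}$ consists of $I$, a non-empty set $A$ (the \emph{objects}), maps $\rho_i:A\to A$ for $i\in I$, and generalized Cartan matrices $C^a=(c^a_{jk})_{j,k\in I}$ for $a\in A$, such that $\rho_i^2=\mathrm{id}$ and $c^a_{ij}=c^{\rho_i(a)}_{ij}$ for all $i,j\in I$, $a\in A$. Let $\sigma_i^a\in\mathrm{Aut}(\mathbb{Z}^I)$ be given by $\sigma_i^a(\alpha_j)=\alpha_j-c^a_{ij}\alpha_i$ for all $j\in I$. A \emph{root system of type $\mathcal{C}$} is a family $(R^a)_{a\in A}$ of subsets of $\mathbb{Z}^I$ such that, for all $a\in A$ and $i,j\in I$, 1. $R^a=R^a_+\cup -R^a_+$, where $R^a_+=R^a\cap\mathbb{N}_0^I$; 2. $R^a\cap\mathbb{Z}\alpha_i=\{\alpha_i,-\alpha_i\}$;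 3. $\sigma_i^a(R^a)=R^{\rho_i(a)}$; 4. if $i\ne j$ and $m=|R^a\cap(\mathbb{N}_0\alpha_i+\mathbb{N}_0\alpha_j)|$ is finite, then $(\rho_i\rho_j)^m(a)=a$. Its \emph{rank} is $|I|$, and it is called \emph{finite} if $R^a$ is finite for all $a\in A$. A root system $(R^a)_{a\in A}$ of type $\mathcal{C}$ and a root system $(R'^{a})_{a\in A'}$ of type $\mathcal{C}'$ are \emph{equivalent} if there are bijections $\varphi_0:I\to I'$ and $\varphi_1:A\to A'$ with $\varphi_1(\rho_i(a))=\rho'_{\varphi_0(i)}(\varphi_1(a))$, $c'^{\varphi_1(a)}_{\varphi_0(i)\varphi_0(j)}=c^a_{ij}$ and $\varphi_0^*(R^a)=R'^{\varphi_1(a)}$ for all $i,j\in I$, $a\in A$, where $\varphi_0^*:\mathbb{Z}^I\to\mathbb{Z}^{I'}$ is the linear map with $\varphi_0^*(\alpha_i)=\alpha_{\varphi_0(i)}$. **Corollary.** Let $r,n$ be natural numbers. For any sets $I$ and $A$ with $|I|=r$ and $|A|=n$ there are only finitely many pairs consisting of a Cartan scheme $\mathcal{C}$ with index set $I$ and object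 set $A$ and a finite root system of type $\mathcal{C}$. Consequently, up to equivalence there are only finitely many finite root systems of rank $r$ with $n$ objects: there is a finite list of such root systems such that every finite root system of rank $r$ with $n$ objects is equivalent to exactly one member of the list. -/

import Mathlib

open scoped Pointwise

universe u v

/-- Generalized Cartan matrices with integer entries. -/
structure IsGeneralizedCartanMatrix {I : Type*} (M : Matrix I I ℤ) : Prop where
  diag : ∀ i, M i i = 2
  off_diag_nonpos : ∀ j k, j ≠ k → M j k ≤ 0
  zero_symm : ∀ i j, M i j = 0 → M j i = 0

/-- A Cartan scheme with index set `I` and object set `A`: maps `ρ i : A → A` and a generalized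
Cartan matrix `cartan a` for each object `a`. Both sets are required to be non-empty. -/
structure CartanScheme (I A : Type*) where
  nonempty_index : Nonempty I
  nonempty_obj : Nonempty A
  ρ : I → A → A
  cartan : A → Matrix I I ℤ
  isGCM : ∀ a, IsGeneralizedCartanMatrix (cartan a)
  ρ_ρ : ∀ i a, ρ i (ρ i a) = a
  cartan_ρ : ∀ a i j, cartan (ρ i a) i j = cartan a i j

/-- The standard basis vector `α_i` of `ℤ^I`. -/
abbrev simpleRoot {I : Type*} [DecidableEq I] (i : I) : I → ℤ := Pi.single i 1

namespace CartanScheme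

variable {I A : Type*}

/-- The linear form `α_j ↦ c^a_{ij}` on `ℤ^I`. -/
def cartanForm [Fintype I] (C : CartanScheme I A) (i : I) (a : A) : Module.Dual ℤ (I → ℤ) :=
  ∑ j, C.cartan a i j • LinearMap.proj j

theorem cartanForm_simpleRoot [Fintype I] [DecidableEq I] (C : CartanScheme I A) (i : I) (a : A)
    (j : I) : C.cartanForm i a (simpleRoot j) = C.cartan a i j := by
  simp [cartanForm, Pi.single_apply]

theorem cartanForm_self [Fintype I] [DecidableEq I] (C : CartanScheme I A) (i : I) (a : A) :
    C.cartanForm i a (simpleRoot i) = 2 := by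
  rw [cartanForm_simpleRoot, (C.isGCM a).diag]

/-- The reflection `σ_i^a ∈ Aut(ℤ^I)`, see `σ_simpleRoot`. -/
def σ [Fintype I] [DecidableEq I] (C : CartanScheme I A) (i : I) (a : A) :
    (I → ℤ) ≃ₗ[ℤ] (I → ℤ) :=
  Module.reflection (C.cartanForm_self i a)

theorem σ_simpleRoot [Fintype I] [DecidableEq I] (C : CartanScheme I A) (i : I) (a : A) (j : I) :
    C.σ i a (simpleRoot j) = simpleRoot j - C.cartan a i j • simpleRoot i := by
  rw [σ, Module.reflection_apply, cartanForm_simpleRoot]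

end CartanScheme

/-- The vectors of a subset of `ℤ^I` which lie in `ℕ₀^I`. -/
def positivePart {I : Type*} (S : Set (I → ℤ)) : Set (I → ℤ) := {v ∈ S | ∀ k, 0 ≤ v k}

/-- The elements of a subset of `ℤ^I` which lie in `ℕ₀ α_i + ℕ₀ α_j`. For `S = R^a`, the number of
its elements is `m_{i,j}^a`. -/
def rankTwoPart {I : Type*} [DecidableEq I] (S : Set (I → ℤ)) (i j : I) : Set (I → ℤ) :=
  {v ∈ S | ∃ p q : ℕ, v = p • simpleRoot i + q • simpleRoot j}

/-- A root system of type `C`, where `C` is a Cartan scheme: a family of subsets of `ℤ^I`, indexed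
by the objects of `C`, compatible with the positive cone, the simple roots, the reflections and the
maps `ρ i`. -/
structure SchemeRootSystem {I A : Type*} [Fintype I] [DecidableEq I] (C : CartanScheme I A) where
  roots : A → Set (I → ℤ)
  pos_union_neg : ∀ a, roots a = positivePart (roots a) ∪ -positivePart (roots a)
  multiples : ∀ i a, {v ∈ roots a | ∃ t : ℤ, v = t • simpleRoot i} = {simpleRoot i, -simpleRoot i}
  σ_image : ∀ i a, C.σ i a '' roots a = roots (C.ρ i a)
  iterate_ρ : ∀ i j a, i ≠ j → (rankTwoPart (roots a) i j).Finite →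
    (C.ρ i ∘ C.ρ j)^[(rankTwoPart (roots a) i j).ncard] a = a

namespace SchemeRootSystem

/-- A root system is finite if all its root sets `R^a` are finite. -/
def IsFinite {I A : Type*} [Fintype I] [DecidableEq I] {C : CartanScheme I A}
    (R : SchemeRootSystem C) : Prop :=
  ∀ a, (R.roots a).Finite

/-- Equivalence of root systems: bijections `φ₀` between the index sets and `φ₁` between the object
sets which form an equivalence of the Cartan schemes (first two clauses) and for which the linear
map `α_i ↦ α_{φ₀ i}`, that is `v ↦ v ∘ φ₀⁻¹`, maps `R^a` onto `R'^{φ₁ a}`. -/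
def Equivalent {I A I' A' : Type*} [Fintype I] [DecidableEq I] [Fintype I'] [DecidableEq I']
    {C : CartanScheme I A} {C' : CartanScheme I' A'}
    (R : SchemeRootSystem C) (R' : SchemeRootSystem C') : Prop :=
  ∃ (φ₀ : I ≃ I') (φ₁ : A ≃ A'),
    (∀ i a, φ₁ (C.ρ i a) = C'.ρ (φ₀ i) (φ₁ a)) ∧
    (∀ a i j, C'.cartan (φ₁ a) (φ₀ i) (φ₀ j) = C.cartan a i j) ∧
    ∀ a, LinearEquiv.funCongrLeft ℤ ℤ φ₀.symm '' R.roots a = R'.roots (φ₁ a)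

end SchemeRootSystem

/-- A Cartan scheme with index set `I` and object set `A`, together with a finite root system of
that type. -/
structure FiniteRootSystem (I A : Type*) [Fintype I] [DecidableEq I] where
  scheme : CartanScheme I A
  rootSystem : SchemeRootSystem scheme
  isFinite : rootSystem.IsFinite

/-! In a finite root system every root is real, i.e. the image of a simple root under a morphism of
the Weyl groupoid (`exists_morphism_of_mem`). Hence the Cartan scheme determines the root sets
(`eq_of_isFinite`), and it suffices to bound the Cartan entries once `I` and `A` are fixed.

First, the number of roots is bounded. Write a root at `a` as `F α_l` with `F` a morphism from `b`
to `a`. Two morphisms `F`, `F'` from `b` to `a` differ by an automorphism preserving the finite set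
`R^a`, hence of finite order; if they agree modulo 3, Minkowski's lemma makes them equal. So `(b, l,
F mod 3)` determines the root, and there are finitely many such triples.

Second, the whole string `α_j + K α_i`, `0 ≤ K ≤ -c_ij`, consists of roots (`string_mem`), so `-c_ij
< |R^a|`.

For the classification up to equivalence, structures are transported to `Fin r` and `Fin n`, and one
representative of each class is chosen. -/

/-! ### Finite root systems consist of real roots -/

namespace CartanScheme

variable {I A : Type*} [Fintype I] [DecidableEq I]

theorem σ_apply (C : CartanScheme I A) (i : I) (a : A) (v : I → ℤ) :
    C.σ i a v = v - C.cartanForm i a v • simpleRoot i := by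
  rw [σ, Module.reflection_apply]

theorem σ_σ (C : CartanScheme I A) (i : I) (a : A) (v : I → ℤ) :
    C.σ i a (C.σ i a v) = v :=
  Module.involutive_reflection (C.cartanForm_self i a) v

theorem σ_apply_of_ne (C : CartanScheme I A) {i k : I} (h : k ≠ i) (a : A) (v : I → ℤ) :
    C.σ i a v k = v k := by
  simp [σ_apply, h]

theorem σ_simpleRoot_self (C : CartanScheme I A) (i : I) (a : A) :
    C.σ i a (simpleRoot i) = -simpleRoot i := by
  rw [σ_simpleRoot, (C.isGCM a).diag, two_smul]; abel

/-- `C.Morphism a b F` says that `F` is a composition of reflections which leads from the object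
`b` to the object `a` in the Weyl groupoid of `C`. -/
inductive Morphism (C : CartanScheme I A) (a : A) : A → ((I → ℤ) ≃ₗ[ℤ] (I → ℤ)) → Prop
  | refl : Morphism C a a (LinearEquiv.refl ℤ _)
  | step {b : A} {F : (I → ℤ) ≃ₗ[ℤ] (I → ℤ)} (i : I) (h : Morphism C a b F) :
      Morphism C a (C.ρ i b) ((C.σ i b).trans F)

end CartanScheme

namespace SchemeRootSystem

variable {I A : Type*} [Fintype I] [DecidableEq I] {C : CartanScheme I A}

theorem simpleRoot_mem (R : SchemeRootSystem C) (i : I) (a : A) : simpleRoot i ∈ R.roots a := by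
  have h : simpleRoot i ∈ {v ∈ R.roots a | ∃ t : ℤ, v = t • simpleRoot i} := by
    rw [R.multiples]; simp
  exact h.1

theorem σ_mem_iff (R : SchemeRootSystem C) (i : I) (a : A) (v : I → ℤ) :
    C.σ i a v ∈ R.roots a ↔ v ∈ R.roots (C.ρ i a) := by
  rw [← R.σ_image i a]
  constructor
  · exact fun h => ⟨_, h, C.σ_σ i a v⟩
  · rintro ⟨w, hw, rfl⟩
    rwa [C.σ_σ]

theorem mem_iff_of_morphism (R : SchemeRootSystem C) {a b : A} {F : (I → ℤ) ≃ₗ[ℤ] (I → ℤ)}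
    (h : C.Morphism a b F) (v : I → ℤ) : F v ∈ R.roots a ↔ v ∈ R.roots b := by
  induction h generalizing v with
  | refl => rfl
  | step i h ih => rw [LinearEquiv.trans_apply, ih, R.σ_mem_iff]

theorem neg_mem (R : SchemeRootSystem C) {a : A} {v : I → ℤ} (h : v ∈ R.roots a) :
    -v ∈ R.roots a := by
  rw [R.pos_union_neg a] at h ⊢
  rcases h with h | h
  · exact Or.inr (by simpa using h)
  · exact Or.inl h

theorem nonneg_or_nonpos (R : SchemeRootSystem C) {a : A} {v : I → ℤ} (h : v ∈ R.roots a) :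
    (∀ k, 0 ≤ v k) ∨ (∀ k, v k ≤ 0) := by
  rw [R.pos_union_neg a] at h
  rcases h with h | h
  · exact Or.inl h.2
  · exact Or.inr fun k => by simpa using h.2 k

theorem ne_zero (R : SchemeRootSystem C) [Nonempty I] {a : A} {v : I → ℤ} (h : v ∈ R.roots a) :
    v ≠ 0 := by
  rintro rfl
  obtain ⟨i⟩ := ‹Nonempty I›
  have h' : (0 : I → ℤ) ∈ {v ∈ R.roots a | ∃ t : ℤ, v = t • simpleRoot i} := ⟨h, 0, by simp⟩
  rw [R.multiples] at h'
  rcases h' with h' | h' <;> simpa using congrFun h' i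

/-- A reflection `σ_i` changes only the `i`-th coordinate, so a positive root that becomes negative
is supported on `i`, and the only positive root in `ℤ α_i` is `α_i`. -/
theorem σ_nonneg (R : SchemeRootSystem C) {a : A} {i : I} {v : I → ℤ} (hv : v ∈ R.roots a)
    (hpos : ∀ k, 0 ≤ v k) (hne : v ≠ simpleRoot i) : ∀ k, 0 ≤ C.σ i a v k := by
  have hmem : C.σ i a v ∈ R.roots (C.ρ i a) := by rw [← R.σ_mem_iff, C.σ_σ]; exact hv
  rcases R.nonneg_or_nonpos hmem with h | h
  · exact h
  exfalso
  have hz : ∀ k, k ≠ i → v k = 0 := fun k hk =>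
    le_antisymm (by simpa [C.σ_apply_of_ne hk] using h k) (hpos k)
  have h' : v ∈ {v ∈ R.roots a | ∃ t : ℤ, v = t • simpleRoot i} := by
    refine ⟨hv, v i, funext fun k => ?_⟩
    by_cases hk : k = i
    · subst hk; simp
    · simp [hz k hk, hk]
  rw [R.multiples] at h'
  rcases h' with h' | h'
  · exact hne h'
  · have := hpos i
    rw [h'] at this
    simp at this

/-- Apply the reflections composing `F` to `v` one at a time. The sign must flip at some step, and a
reflection flips only its own simple root; the remaining reflections then carry that simple root to
`F v`. -/
theorem exists_morphism_of_inversion (R : SchemeRootSystem C) {a b : A}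
    {F : (I → ℤ) ≃ₗ[ℤ] (I → ℤ)} (h : C.Morphism a b F) {v : I → ℤ} (hv : v ∈ R.roots b)
    (hneg : ∀ k, v k ≤ 0) (hpos : ∀ k, 0 ≤ F v k) :
    ∃ (b' : A) (l : I) (G : (I → ℤ) ≃ₗ[ℤ] (I → ℤ)), C.Morphism a b' G ∧
      G (simpleRoot l) = F v := by
  induction h generalizing v with
  | refl =>
    have := C.nonempty_index
    exact absurd (funext fun k => le_antisymm (hneg k) (hpos k)) (R.ne_zero hv)
  | @step b F i h ih =>
    by_cases hi : C.σ i b v = simpleRoot i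
    · exact ⟨b, i, F, h, by rw [← hi]; rfl⟩
    · have hmem : C.σ i b v ∈ R.roots b := (R.σ_mem_iff i b v).2 hv
      refine ih hmem ?_ hpos
      rcases R.nonneg_or_nonpos hmem with h1 | h1
      · have h2 := R.σ_nonneg hmem h1 hi
        rw [C.σ_σ] at h2
        have := C.nonempty_index
        exact absurd (funext fun k => le_antisymm (hneg k) (h2 k)) (R.ne_zero hv)
      · exact h1

/-- Some morphism of the Weyl groupoid maps all simple roots to negative roots. -/
theorem exists_longest_morphism (R : SchemeRootSystem C) {a : A} (hfin : (R.roots a).Finite) :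
    ∃ (b : A) (F : (I → ℤ) ≃ₗ[ℤ] (I → ℤ)), C.Morphism a b F ∧
      ∀ l k, F (simpleRoot l) k ≤ 0 := by
  -- Inversion sets are subsets of the finite set `R^a`, so a maximal one exists. If `F α_l` were
  -- positive, appending `σ_l` would keep all inversions and add `F α_l`.
  let inv : ((I → ℤ) ≃ₗ[ℤ] (I → ℤ)) → Set (I → ℤ) := fun F =>
    {w ∈ R.roots a | (∀ k, 0 ≤ w k) ∧ ∀ k, F.symm w k ≤ 0}
  have hS : {N | ∃ b F, C.Morphism a b F ∧ N = inv F}.Finite :=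
    hfin.finite_subsets.subset (by rintro _ ⟨b, F, -, rfl⟩; exact fun w hw => hw.1)
  obtain ⟨N, hN⟩ := hS.exists_maximal ⟨_, a, _, .refl, rfl⟩
  obtain ⟨⟨b, F, hF, rfl⟩, hmax⟩ := hN
  refine ⟨b, F, hF, fun l => ?_⟩
  have hmem : F (simpleRoot l) ∈ R.roots a := (R.mem_iff_of_morphism hF _).2 (R.simpleRoot_mem l b)
  rcases R.nonneg_or_nonpos hmem with hl | hl
  swap
  · exact hl
  exfalso
  have hsymm : ∀ w, ((C.σ l b).trans F).symm w = C.σ l b (F.symm w) := fun w => by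
    rw [LinearEquiv.symm_apply_eq, LinearEquiv.trans_apply, C.σ_σ, LinearEquiv.apply_symm_apply]
  have hsub : inv F ⊆ inv ((C.σ l b).trans F) := by
    rintro w ⟨hw, hw0, hw1⟩
    refine ⟨hw, hw0, fun k => ?_⟩
    have hw' : F.symm w ∈ R.roots b := by
      rw [← R.mem_iff_of_morphism hF, LinearEquiv.apply_symm_apply]; exact hw
    have h2 := R.σ_nonneg (i := l) (R.neg_mem hw') (fun k => by simpa using hw1 k) (by
      intro h
      have h3 : F (simpleRoot l) = -w := by rw [← h]; simp
      have := C.nonempty_index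
      refine R.ne_zero hw (funext fun k => le_antisymm ?_ (hw0 k))
      have := hl k
      rw [h3] at this
      simpa using this) k
    rw [hsymm]
    simpa using h2
  have h1 : F (simpleRoot l) ∈ inv ((C.σ l b).trans F) := by
    refine ⟨hmem, hl, fun k => ?_⟩
    rw [hsymm, LinearEquiv.symm_apply_apply, C.σ_simpleRoot_self]
    by_cases hk : k = l
    · subst hk; simp
    · simp [hk]
  have h2 := hmax ⟨_, _, hF.step l, rfl⟩ hsub h1
  have := h2.2.2 l
  simp at this

/-- All roots of a finite root system are real. -/
theorem exists_morphism_of_mem (R : SchemeRootSystem C) {a : A} (hfin : (R.roots a).Finite)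
    {w : I → ℤ} (hw : w ∈ R.roots a) :
    ∃ (b : A) (l : I) (F : (I → ℤ) ≃ₗ[ℤ] (I → ℤ)), C.Morphism a b F ∧ F (simpleRoot l) = w := by
  have key : ∀ w ∈ R.roots a, (∀ k, 0 ≤ w k) → ∃ (b : A) (l : I) (F : (I → ℤ) ≃ₗ[ℤ] (I → ℤ)),
      C.Morphism a b F ∧ F (simpleRoot l) = w := by
    intro w hw hpos
    obtain ⟨b, F, hF, hneg⟩ := R.exists_longest_morphism hfin
    have hmem : F.symm w ∈ R.roots b := by
      rw [← R.mem_iff_of_morphism hF, LinearEquiv.apply_symm_apply]; exact hw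
    rcases R.nonneg_or_nonpos hmem with h | h
    -- A nonnegative `F.symm w` would make `w` a nonnegative combination of the vectors `F α_l`,
    -- none of which has a positive coordinate.
    · have := C.nonempty_index
      refine absurd (funext fun k => le_antisymm ?_ (hpos k)) (R.ne_zero hw)
      have hsum : w = ∑ l, F.symm w l • F (simpleRoot l) := by
        conv_lhs => rw [← F.apply_symm_apply w, pi_eq_sum_univ' (F.symm w)]
        simp only [map_sum, map_smul]
      rw [hsum, Finset.sum_apply]
      exact Finset.sum_nonpos fun l _ => by
        simpa using mul_nonpos_of_nonneg_of_nonpos (h l) (hneg l k)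
    · obtain ⟨b', l, G, hG, h'⟩ := R.exists_morphism_of_inversion hF hmem h (by simpa using hpos)
      exact ⟨b', l, G, hG, by simpa using h'⟩
  rcases R.nonneg_or_nonpos hw with h | h
  · exact key w hw h
  · obtain ⟨b, l, F, hF, h'⟩ := key (-w) (R.neg_mem hw) (fun k => by simpa using h k)
    refine ⟨C.ρ l b, l, _, hF.step l, ?_⟩
    rw [LinearEquiv.trans_apply, C.σ_simpleRoot_self, map_neg, h', neg_neg]

/-- Real roots depend on the scheme alone, so they lie in every root system of that type. -/
theorem roots_subset (R R' : SchemeRootSystem C) {a : A} (hfin : (R.roots a).Finite) :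
    R.roots a ⊆ R'.roots a := by
  intro w hw
  obtain ⟨b, l, F, hF, rfl⟩ := R.exists_morphism_of_mem hfin hw
  exact (R'.mem_iff_of_morphism hF _).2 (R'.simpleRoot_mem l b)

theorem eq_of_isFinite (R R' : SchemeRootSystem C) (h : R.IsFinite) (h' : R'.IsFinite) :
    R = R' := by
  have : R.roots = R'.roots := funext fun a =>
    (R.roots_subset R' (h a)).antisymm (R'.roots_subset R (h' a))
  cases R; cases R'; cases this; rfl

end SchemeRootSystem

/-! ### Minkowski's lemma modulo 3 -/

theorem exists_one_add_pow_eq {R : Type*} [Ring R] (y : R) (q : ℕ) :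
    ∃ z, (1 + y) ^ q = 1 + q • y + y * y * z := by
  induction q with
  | zero => exact ⟨0, by simp⟩
  | succ q ih =>
    obtain ⟨z, hz⟩ := ih
    refine ⟨z + z * y + q • 1, ?_⟩
    rw [pow_succ, hz, succ_nsmul]
    simp only [nsmul_eq_mul]
    have hc : y * (q : R) = q * y := (Nat.cast_commute q y).symm
    have : y * y * ((q : R) * 1) = q * y * y := by rw [mul_one, mul_assoc, hc, ← mul_assoc, hc]
    rw [mul_add, mul_add, this]
    noncomm_ring

theorem Matrix.eq_zero_of_three_pow_dvd {I : Type*} {X : Matrix I I ℤ}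
    (h : ∀ k : ℕ, ∃ Y : Matrix I I ℤ, X = (3 ^ k : ℤ) • Y) : X = 0 := by
  ext i j
  by_contra hne
  obtain ⟨Y, hY⟩ := h (X i j).natAbs
  have h1 : (3 ^ (X i j).natAbs : ℤ) ∣ X i j := ⟨Y i j, congrFun (congrFun hY i) j⟩
  have h2 := Nat.le_of_dvd (Int.natAbs_pos.2 hne) (by simpa using Int.natAbs_dvd_natAbs.2 h1)
  exact absurd h2 (not_le.2 (by simpa [Int.natAbs_pow] using Nat.lt_pow_self (by norm_num : 1 < 3)))

/-- If `3 ^ k` divides `X`, then `3 ^ (k + 1)` divides `q X`, hence also `X` by the Bézout relation;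
so `X` is divisible by every power of 3. -/
theorem Matrix.eq_zero_of_smul_eq {I : Type*} [Fintype I] [DecidableEq I] {X Z : Matrix I I ℤ}
    {q : ℤ} (hq : IsCoprime q 3) (h : q • X = (3 : ℤ) • (X * Z)) : X = 0 := by
  obtain ⟨s, t, hst⟩ := hq
  refine Matrix.eq_zero_of_three_pow_dvd fun k => ?_
  induction k with
  | zero => exact ⟨X, by simp⟩
  | succ k ih =>
    obtain ⟨Y, hY⟩ := ih
    refine ⟨s • (Y * Z) + t • Y, ?_⟩
    calc X = (s * q + t * 3) • X := by rw [hst, one_smul]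
      _ = s • (q • X) + (t * 3) • X := by rw [add_smul, mul_smul]
      _ = s • ((3 : ℤ) • (X * Z)) + (t * 3) • X := by rw [h]
      _ = _ := by
        rw [hY, Matrix.smul_mul, smul_add, smul_smul, smul_smul, smul_smul, smul_smul, smul_smul]
        congr 2 <;> ring

/-- Minkowski's lemma: an integral matrix of finite order which is congruent to the identity
modulo `3` is the identity. -/
theorem Matrix.eq_zero_of_one_add_three_smul_pow {I : Type*} [Fintype I] [DecidableEq I]
    {X : Matrix I I ℤ} {q : ℕ} (hq : q ≠ 0) (h : (1 + (3 : ℤ) • X) ^ q = 1) : X = 0 := by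
  induction q using Nat.strong_induction_on generalizing X with
  | _ q ih =>
  by_cases h3 : 3 ∣ q
  · obtain ⟨p, rfl⟩ := h3
    -- The cube is again congruent to 1 modulo 3 and has the smaller exponent `p`. The induction
    -- hypothesis leaves `X + 3X² + 3X³ = 0`, so `X = 3X · (-(X + X²))`.
    have hcube : (1 + (3 : ℤ) • X) ^ 3 = 1 + (3 : ℤ) • ((3 : ℤ) • (X + (3 : ℤ) • (X * X) +
        (3 : ℤ) • (X * X * X))) := by
      simp only [pow_succ, pow_zero]
      noncomm_ring
    rw [pow_mul, hcube] at h
    have h0 := (smul_eq_zero.1 (ih p (by omega) (by omega) h)).resolve_left (by norm_num)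
    refine Matrix.eq_zero_of_smul_eq (q := 1) (Z := -(X + X * X)) isCoprime_one_left ?_
    rw [one_smul, mul_neg, smul_neg, mul_add, smul_add, ← mul_assoc, eq_neg_iff_add_eq_zero,
      ← add_assoc, h0]
  -- The expansion modulo the square of `3X` gives `q X = -3 X² Z`, with `q` prime to 3.
  · obtain ⟨Z, hZ⟩ := exists_one_add_pow_eq ((3 : ℤ) • X) q
    rw [h, add_assoc, left_eq_add] at hZ
    have hcop : IsCoprime (q : ℤ) 3 := by
      have := (Nat.prime_three.coprime_iff_not_dvd.2 h3).symm
      exact_mod_cast this.isCoprime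
    refine Matrix.eq_zero_of_smul_eq (Z := -(X * Z)) hcop ?_
    have h9 : (3 : ℤ) • ((q : ℤ) • X + (3 : ℤ) • (X * (X * Z))) = 0 := by
      rw [← hZ, smul_add, ← natCast_zsmul, smul_comm, Matrix.smul_mul, Matrix.smul_mul,
        Matrix.mul_smul, Matrix.smul_mul, mul_assoc]
    have := (smul_eq_zero.1 h9).resolve_left (by norm_num)
    rw [mul_neg, smul_neg]
    exact eq_neg_of_add_eq_zero_left this

/-! ### Bounding the number of roots -/

namespace SchemeRootSystem

variable {I A : Type*} [Fintype I] [DecidableEq I] {C : CartanScheme I A}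

/-- A linear map which preserves a finite root set has finite order. -/
theorem exists_pow_eq_one (R : SchemeRootSystem C) {a : A} (hfin : (R.roots a).Finite)
    (G : (I → ℤ) ≃ₗ[ℤ] (I → ℤ)) (hG : ∀ v, G v ∈ R.roots a ↔ v ∈ R.roots a) :
    ∃ q : ℕ, q ≠ 0 ∧ G ^ q = 1 := by
  have hpow : ∀ (k : ℕ) (i : I), (G ^ k) (simpleRoot i) ∈ R.roots a := by
    intro k i
    induction k with
    | zero => exact R.simpleRoot_mem i a
    | succ k ih => rw [pow_succ', LinearEquiv.mul_apply, hG]; exact ih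
  have : Finite (R.roots a) := hfin
  -- A power of `G` is determined by the images of the simple roots, which range over a finite set,
  -- so two powers coincide.
  obtain ⟨k, l, hkl, h⟩ := Finite.exists_ne_map_eq_of_infinite
    (fun (k : ℕ) (i : I) => (⟨(G ^ k) (simpleRoot i), hpow k i⟩ : R.roots a))
  have heq : G ^ k = G ^ l := by
    apply LinearEquiv.toLinearMap_injective
    refine LinearMap.pi_ext' fun i => LinearMap.ext_ring ?_
    simpa using congrArg Subtype.val (congrFun h i)
  rcases lt_or_gt_of_ne hkl with h | h
  · exact ⟨l - k, by omega, by rw [pow_sub G h.le, heq, mul_inv_cancel]⟩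
  · exact ⟨k - l, by omega, by rw [pow_sub G h.le, heq, mul_inv_cancel]⟩

/-- Morphisms of the Weyl groupoid of a finite root system are determined by their reduction
modulo `3`. -/
theorem morphism_eq_of_congr (R : SchemeRootSystem C) {a b : A} (hfin : (R.roots a).Finite)
    {F F' : (I → ℤ) ≃ₗ[ℤ] (I → ℤ)} (h : C.Morphism a b F) (h' : C.Morphism a b F')
    (hmod : ∀ i j, ((F (simpleRoot j) i : ℤ) : ZMod 3) = (F' (simpleRoot j) i : ℤ)) :
    F = F' := by
  obtain ⟨q, hq, hpow⟩ := R.exists_pow_eq_one hfin (F' * F⁻¹) (fun v => by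
    have h1 := R.mem_iff_of_morphism h (F⁻¹ v)
    rw [← LinearEquiv.mul_apply, mul_inv_cancel] at h1
    rw [LinearEquiv.mul_apply, R.mem_iff_of_morphism h', ← h1]
    rfl)
  let M : ((I → ℤ) ≃ₗ[ℤ] (I → ℤ)) →* Matrix I I ℤ :=
    (LinearMap.toMatrixAlgEquiv' (R := ℤ) (n := I)).toRingEquiv.toMonoidHom.comp
      (LinearEquiv.automorphismGroup.toLinearMapMonoidHom)
  have hM : ∀ (G : (I → ℤ) ≃ₗ[ℤ] (I → ℤ)) i j, M G i j = G (simpleRoot j) i := fun G i j => by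
    simp [M, LinearMap.toMatrixAlgEquiv'_apply]
  have hY : ∃ Y : Matrix I I ℤ, M F' = M F + (3 : ℤ) • Y := by
    have : ∀ i j, ∃ y, M F' i j = M F i j + 3 * y := fun i j => by
      have h3 := (ZMod.intCast_eq_intCast_iff_dvd_sub _ _ 3).1 (hmod i j)
      obtain ⟨y, hy⟩ := h3
      exact ⟨y, by rw [hM, hM]; push_cast at hy; linarith⟩
    choose Y hY using this
    exact ⟨Matrix.of Y, by ext i j; simp [hY]⟩
  obtain ⟨Y, hY⟩ := hY
  have hone : M F * M F⁻¹ = 1 := by rw [← map_mul, mul_inv_cancel, map_one]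
  have hG : M (F' * F⁻¹) = 1 + (3 : ℤ) • (Y * M F⁻¹) := by
    rw [map_mul, hY, add_mul, hone, Matrix.smul_mul]
  have hX := Matrix.eq_zero_of_one_add_three_smul_pow (X := Y * M F⁻¹) hq (by
    rw [← hG, ← map_pow, hpow, map_one])
  have hMM : M F' = M F := by
    calc M F' = M (F' * F⁻¹) * M F := by rw [← map_mul, inv_mul_cancel_right]
      _ = M F := by rw [hG, hX, smul_zero, add_zero, one_mul]
  apply LinearEquiv.toLinearMap_injective
  refine LinearMap.pi_ext' fun j => LinearMap.ext_ring (funext fun i => ?_)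
  simpa [hM] using congrFun (congrFun hMM.symm i) j

/-- The number of roots at an object is bounded in terms of the rank and the number of objects. -/
theorem ncard_roots_le [Fintype A] (R : SchemeRootSystem C) {a : A}
    (hfin : (R.roots a).Finite) :
    (R.roots a).ncard ≤ Fintype.card (A × I × (I → I → ZMod 3)) := by
  have hex : ∀ w : R.roots a, ∃ (b : A) (l : I) (F : (I → ℤ) ≃ₗ[ℤ] (I → ℤ)),
      C.Morphism a b F ∧ F (simpleRoot l) = w := fun w => R.exists_morphism_of_mem hfin w.2
  choose b l F hF hw using hex
  have := hfin.fintype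
  rw [← Nat.card_coe_set_eq, Nat.card_eq_fintype_card]
  refine Fintype.card_le_of_injective
    (fun w => (b w, l w, fun i j => ((F w (simpleRoot j) i : ℤ) : ZMod 3))) fun w w' h => ?_
  simp only [Prod.mk.injEq] at h
  obtain ⟨hb, hl, hm⟩ := h
  have hFF : F w = F w' := R.morphism_eq_of_congr hfin (hF w) (hb ▸ hF w')
    (fun i j => congrFun (congrFun hm i) j)
  exact Subtype.ext (by rw [← hw w, ← hw w', hFF, hl])

/-! ### Root strings and the bound on Cartan entries -/

/-- A pair of consecutive roots `β', β` on the walk around the plane spanned by `α_i` and `α_j`,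
where `β` lies strictly between `α_i` and the ray through `K α_i + α_j`. -/
structure IsStringState (C : CartanScheme I A) (a : A) (i j : I) (K : ℤ) (β' β : I → ℤ) :
    Prop where
  exists_morphism : ∃ (b : A) (F : (I → ℤ) ≃ₗ[ℤ] (I → ℤ)) (l l' : I), l ≠ l' ∧
    C.Morphism a b F ∧ F (simpleRoot l) = β ∧ F (simpleRoot l') = -β'
  off : ∀ k, k ≠ i → k ≠ j → β k = 0 ∧ β' k = 0
  det : β' i * β j - β i * β' j = 1
  pos : 0 < β j
  below : 0 < β i - K * β j

/-- The walk can be continued as long as `K α_i + α_j` is not a root. -/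
theorem IsStringState.exists_next (R : SchemeRootSystem C) {a : A} {i j : I} (hij : i ≠ j) {K : ℤ}
    (hK : 0 < K) (hnot : simpleRoot j + K • simpleRoot i ∉ R.roots a) {β' β : I → ℤ}
    (h : IsStringState C a i j K β' β) : ∃ γ, IsStringState C a i j K β γ := by
  obtain ⟨⟨b, F, l, l', hl, hF, hβ, hβ'⟩, hoff, hdet, hpos, hg⟩ := h
  let c : ℤ := C.cartan b l l'
  have hFl : ((C.σ l b).trans F) (simpleRoot l) = -β := by
    rw [LinearEquiv.trans_apply, C.σ_simpleRoot_self, map_neg, hβ]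
  have hFl' : ((C.σ l b).trans F) (simpleRoot l') = -β' - c • β := by
    rw [LinearEquiv.trans_apply, C.σ_simpleRoot, map_sub, map_smul, hβ, hβ']
  -- The next root of the walk is the image of `α_l'` after appending `σ_l`. The cases below ask
  -- whether it lies beyond, on or before the ray through `K α_i + α_j`.
  obtain ⟨γ, hγ⟩ : ∃ γ, γ = -β' - c • β := ⟨_, rfl⟩
  rw [← hγ] at hFl'
  have hγk : ∀ k, γ k = -β' k - c * β k := fun k => by simp [hγ]
  have hdet' : β i * γ j - γ i * β j = 1 := by rw [hγk, hγk]; linear_combination hdet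
  have hgdet : (β i - K * β j) * γ j - (γ i - K * γ j) * β j = 1 := by
    linear_combination hdet'
  have hoff' : ∀ k, k ≠ i → k ≠ j → γ k = 0 := fun k hi hj => by
    rw [hγk, (hoff k hi hj).1, (hoff k hi hj).2]; ring
  have hmor := hF.step l
  rcases lt_trichotomy (γ i - K * γ j) 0 with hlt | heq | hgt
  · exfalso
    -- Cramer's rule with determinant 1 gives `α_j = β_i γ - γ_i β`. Its preimage is a root, so the
    -- coefficients `β_i` and `γ_i` cannot have opposite signs.
    have hcomb : ((C.σ l b).trans F) (β i • simpleRoot l' + γ i • simpleRoot l) =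
        simpleRoot j := by
      rw [map_add, map_smul, map_smul, hFl, hFl']
      funext k
      simp only [Pi.add_apply, Pi.smul_apply, Pi.neg_apply, smul_eq_mul, Pi.single_apply]
      split_ifs with hk
      · subst hk; linarith
      · by_cases hki : k = i
        · subst hki; ring
        · rw [hoff' k hki hk, (hoff k hki hk).1]; ring
    have hmem := (R.mem_iff_of_morphism hmor _).1 (hcomb ▸ R.simpleRoot_mem j a)
    have hβi : 0 < β i := by nlinarith
    have hγi : 0 ≤ γ i := by
      rcases R.nonneg_or_nonpos hmem with h | h
      · simpa [Pi.single_apply, hl] using h l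
      · have := h l'
        simp [hl.symm] at this
        omega
    have hγj : 0 < γ j := by nlinarith
    -- In `hgdet` the value 1 would be a sum of two positive integers.
    nlinarith
  · exfalso
    -- On the ray, the determinant forces `γ_j = 1`, so `γ` is the excluded vector `K α_i + α_j`.
    rw [heq, zero_mul, sub_zero] at hgdet
    have hγj : γ j = 1 := by
      rcases Int.mul_eq_one_iff_eq_one_or_neg_one.1 hgdet with h | h <;> omega
    apply hnot
    have : simpleRoot j + K • simpleRoot i = γ := by
      funext k
      simp only [Pi.add_apply, Pi.smul_apply, smul_eq_mul, Pi.single_apply]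
      by_cases hki : k = i
      · subst hki; rw [if_neg hij, if_pos rfl]; rw [hγj] at heq; linarith
      · by_cases hkj : k = j
        · subst hkj; simp [hki, hγj]
        · simp [hki, hkj, hoff' k hki hkj]
    rw [this, ← hFl', R.mem_iff_of_morphism hmor]
    exact R.simpleRoot_mem _ _
  · refine ⟨γ, ⟨_, _, l', l, hl.symm, hmor, hFl', hFl⟩,
      fun k hi hj => ⟨hoff' k hi hj, (hoff k hi hj).1⟩, hdet', ?_, hgt⟩
    have : 0 < (β i - K * β j) * γ j := by nlinarith
    exact (mul_pos_iff_of_pos_left hg).1 this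

/-- The `α_i`-string through `α_j`. -/
theorem string_mem (R : SchemeRootSystem C) {a : A} (hfin : (R.roots a).Finite) {i j : I}
    (hij : i ≠ j) {K : ℤ} (hK : 0 ≤ K) (hKc : K ≤ -C.cartan a i j) :
    simpleRoot j + K • simpleRoot i ∈ R.roots a := by
  rcases hK.eq_or_lt with rfl | hK
  · simpa using R.simpleRoot_mem j a
  have hmem : simpleRoot j + (-C.cartan a i j) • simpleRoot i ∈ R.roots a := by
    rw [neg_smul, ← sub_eq_add_neg, ← C.σ_simpleRoot, R.σ_mem_iff]
    exact R.simpleRoot_mem _ _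
  rcases hKc.eq_or_lt with rfl | hKc
  · exact hmem
  by_contra hnot
  let S : Set (I → ℤ) := {β | ∃ β', IsStringState C a i j K β' β}
  have hS : S.Finite := hfin.subset (by
    rintro β ⟨β', ⟨b, F, l, l', -, hF, rfl, -⟩, -⟩
    exact (R.mem_iff_of_morphism hF _).2 (R.simpleRoot_mem l b))
  have hne : S.Nonempty := by
    -- The walk starts with `α_i` followed by `σ_i α_j`, which lies before the ray because `K <
    -- -c_ij`.
    refine ⟨simpleRoot j + (-C.cartan a i j) • simpleRoot i, simpleRoot i,
      ⟨_, _, j, i, hij.symm, CartanScheme.Morphism.refl.step i, ?_, ?_⟩, ?_, ?_, ?_, ?_⟩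
    · rw [LinearEquiv.trans_apply, C.σ_simpleRoot, neg_smul, ← sub_eq_add_neg]; rfl
    · rw [LinearEquiv.trans_apply, C.σ_simpleRoot_self]; rfl
    · intro k hi hj; simp [hi, hj]
    · simp [hij, hij.symm]
    · simp [hij.symm]
    · simp [hij, hij.symm]; linarith
  obtain ⟨β, ⟨β', hβ⟩, hmax⟩ :=
    -- By the determinant condition this ratio strictly increases along the walk, so the walk cannot
    -- continue forever among finitely many roots.
    hS.exists_maximalFor (fun β => (β j : ℚ) / ((β i - K * β j : ℤ) : ℚ)) S hne
  obtain ⟨γ, hγ⟩ := hβ.exists_next R hij hK hnot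
  have hlt : (β j : ℚ) / ((β i - K * β j : ℤ) : ℚ) < (γ j : ℚ) / ((γ i - K * γ j : ℤ) : ℚ) := by
    rw [div_lt_div_iff₀ (by exact_mod_cast hβ.below) (by exact_mod_cast hγ.below)]
    have := hγ.det
    exact_mod_cast (by linarith : β j * (γ i - K * γ j) < γ j * (β i - K * β j))
  exact absurd (hmax ⟨β, hγ⟩ hlt.le) (not_le.2 hlt)

theorem neg_cartan_lt_ncard (R : SchemeRootSystem C) {a : A} (hfin : (R.roots a).Finite) {i j : I}
    (hij : i ≠ j) : -C.cartan a i j < (R.roots a).ncard := by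
  obtain ⟨c, hc⟩ := Int.eq_ofNat_of_zero_le
    (Int.neg_nonneg_of_nonpos ((C.isGCM a).off_diag_nonpos i j hij))
  rw [hc]
  have hinj : Function.Injective fun K : ℕ => simpleRoot j + (K : ℤ) • (simpleRoot i : I → ℤ) :=
    fun K K' h => by simpa [hij] using congrFun h i
  have hsub : ((Finset.range (c + 1)).map ⟨_, hinj⟩ : Set (I → ℤ)) ⊆ R.roots a := by
    intro w hw
    simp only [Finset.coe_map, Set.mem_image, Finset.mem_coe, Finset.mem_range] at hw
    obtain ⟨K, hK, rfl⟩ := hw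
    exact R.string_mem hfin hij (by positivity) (by omega)
  have := Set.ncard_le_ncard hsub hfin
  rw [Set.ncard_coe_finset, Finset.card_map, Finset.card_range] at this
  omega

end SchemeRootSystem

/-! ### Finiteness on fixed index and object sets -/

theorem CartanScheme.ext_of_eq {I A : Type*} {C C' : CartanScheme I A} (hρ : C.ρ = C'.ρ)
    (hc : C.cartan = C'.cartan) : C = C' := by
  cases C; cases C'; cases hρ; cases hc; rfl

namespace FiniteRootSystem

variable {I A : Type*} [Fintype I] [DecidableEq I]

theorem scheme_injective :
    Function.Injective (scheme : FiniteRootSystem I A → CartanScheme I A) := by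
  rintro ⟨C, R, hR⟩ ⟨C', R', hR'⟩ h
  obtain rfl : C = C' := h
  obtain rfl := R.eq_of_isFinite R' hR hR'
  rfl

theorem cartan_mem_Icc [Fintype A] (R : FiniteRootSystem I A) (a : A) (i j : I) :
    R.scheme.cartan a i j ∈
      Set.Icc (-(Fintype.card (A × I × (I → I → ZMod 3)) : ℤ)) 2 := by
  by_cases hij : i = j
  · subst hij
    rw [(R.scheme.isGCM a).diag]
    exact ⟨by omega, le_rfl⟩
  · have h1 := R.rootSystem.neg_cartan_lt_ncard (R.isFinite a) hij
    have h2 := R.rootSystem.ncard_roots_le (R.isFinite a)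
    have h3 := (R.scheme.isGCM a).off_diag_nonpos i j hij
    exact ⟨by omega, by omega⟩

theorem finite_of_fintype [Fintype A] : Finite (FiniteRootSystem I A) := by
  let f : FiniteRootSystem I A → (I → A → A) × (A → I → I →
      Set.Icc (-(Fintype.card (A × I × (I → I → ZMod 3)) : ℤ)) 2) :=
    fun R => (R.scheme.ρ, fun a i j => ⟨_, R.cartan_mem_Icc a i j⟩)
  refine Finite.of_injective f fun R R' h => scheme_injective ?_
  simp only [f, Prod.mk.injEq] at h
  refine CartanScheme.ext_of_eq h.1 (funext fun a => Matrix.ext fun i j => ?_)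
  exact congrArg Subtype.val (congrFun (congrFun (congrFun h.2 a) i) j)

end FiniteRootSystem

/-! ### Equivalence, transport and the list of representatives -/

namespace SchemeRootSystem

variable {I A I' A' I'' A'' : Type*} [Fintype I] [DecidableEq I] [Fintype I'] [DecidableEq I']
  [Fintype I''] [DecidableEq I''] {C : CartanScheme I A} {C' : CartanScheme I' A'}
  {C'' : CartanScheme I'' A''}

theorem Equivalent.refl (R : SchemeRootSystem C) : R.Equivalent R :=
  ⟨Equiv.refl I, Equiv.refl A, fun _ _ => rfl, fun _ _ _ => rfl, fun _ => Set.image_id _⟩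

theorem Equivalent.symm {R : SchemeRootSystem C} {R' : SchemeRootSystem C'}
    (h : R.Equivalent R') : R'.Equivalent R := by
  obtain ⟨φ₀, φ₁, hρ, hc, hR⟩ := h
  refine ⟨φ₀.symm, φ₁.symm, fun i a => ?_, fun a i j => ?_, fun a => ?_⟩
  · rw [Equiv.symm_apply_eq, hρ, Equiv.apply_symm_apply, Equiv.apply_symm_apply]
  · rw [← hc, Equiv.apply_symm_apply, Equiv.apply_symm_apply, Equiv.apply_symm_apply]
  · have h := hR (φ₁.symm a)
    rw [Equiv.apply_symm_apply] at h
    rw [← h, Set.image_image]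
    have : ∀ v : I → ℤ, LinearEquiv.funCongrLeft ℤ ℤ φ₀.symm.symm
        (LinearEquiv.funCongrLeft ℤ ℤ φ₀.symm v) = v := fun v => by
      funext k; simp [LinearEquiv.funCongrLeft_apply, LinearMap.funLeft_apply]
    exact (Set.image_congr fun v _ => this v).trans (Set.image_id' _)

theorem Equivalent.trans {R : SchemeRootSystem C} {R' : SchemeRootSystem C'}
    {R'' : SchemeRootSystem C''} (h : R.Equivalent R') (h' : R'.Equivalent R'') :
    R.Equivalent R'' := by
  obtain ⟨φ₀, φ₁, hρ, hc, hR⟩ := h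
  obtain ⟨ψ₀, ψ₁, hρ', hc', hR'⟩ := h'
  refine ⟨φ₀.trans ψ₀, φ₁.trans ψ₁, fun i a => ?_, fun a i j => ?_, fun a => ?_⟩
  · simp [hρ, hρ']
  · simp [hc, hc']
  · rw [Equiv.trans_apply, ← hR', ← hR, Set.image_image]
    rfl

end SchemeRootSystem

section Transport

variable {I A I' A' : Type*}

/-- Transport of a Cartan scheme along bijections of the index and object sets. -/
def CartanScheme.transport (C : CartanScheme I A) (φ₀ : I ≃ I') (φ₁ : A ≃ A') :
    CartanScheme I' A' where
  nonempty_index := C.nonempty_index.map φ₀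
  nonempty_obj := C.nonempty_obj.map φ₁
  ρ i a := φ₁ (C.ρ (φ₀.symm i) (φ₁.symm a))
  cartan a := (C.cartan (φ₁.symm a)).submatrix φ₀.symm φ₀.symm
  isGCM a :=
    { diag := fun i => (C.isGCM _).diag _
      off_diag_nonpos := fun j k h => (C.isGCM _).off_diag_nonpos _ _ (φ₀.symm.injective.ne h)
      zero_symm := fun i j => (C.isGCM _).zero_symm _ _ }
  ρ_ρ i a := by simp [C.ρ_ρ]
  cartan_ρ a i j := by simp [C.cartan_ρ]

theorem simpleRoot_comp_equiv [DecidableEq I] [DecidableEq I'] (φ₀ : I ≃ I') (i : I') :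
    (simpleRoot i : I' → ℤ) ∘ φ₀ = simpleRoot (φ₀.symm i) := by
  funext k
  simp [Pi.single_apply, Equiv.eq_symm_apply]

variable [Fintype I] [DecidableEq I] [Fintype I'] [DecidableEq I']

theorem CartanScheme.transport_σ_comp (C : CartanScheme I A) (φ₀ : I ≃ I') (φ₁ : A ≃ A') (i : I')
    (a : A') (v : I' → ℤ) :
    (C.transport φ₀ φ₁).σ i a v ∘ φ₀ = C.σ (φ₀.symm i) (φ₁.symm a) (v ∘ φ₀) := by
  have hform : (C.transport φ₀ φ₁).cartanForm i a v =
      C.cartanForm (φ₀.symm i) (φ₁.symm a) (v ∘ φ₀) := by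
    simp only [CartanScheme.cartanForm, LinearMap.sum_apply, LinearMap.smul_apply,
      LinearMap.proj_apply, smul_eq_mul, Function.comp_apply]
    exact (Fintype.sum_equiv φ₀ _ _ fun j => by simp [CartanScheme.transport]).symm
  rw [CartanScheme.σ_apply, CartanScheme.σ_apply, hform, ← simpleRoot_comp_equiv]
  rfl

/-- Transport of a root system along bijections of the index and object sets. -/
def SchemeRootSystem.transport {C : CartanScheme I A} (R : SchemeRootSystem C) (φ₀ : I ≃ I')
    (φ₁ : A ≃ A') : SchemeRootSystem (C.transport φ₀ φ₁) where
  roots a := {v | v ∘ φ₀ ∈ R.roots (φ₁.symm a)}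
  pos_union_neg a := by
    ext v
    have h := Set.ext_iff.1 (R.pos_union_neg (φ₁.symm a)) (v ∘ φ₀)
    simpa [positivePart, φ₀.forall_congr_left, Pi.neg_comp] using h
  multiples i a := by
    ext v
    have h := Set.ext_iff.1 (R.multiples (φ₀.symm i) (φ₁.symm a)) (v ∘ φ₀)
    have hinj := φ₀.surjective.injective_comp_right (γ := ℤ)
    simp only [← simpleRoot_comp_equiv, Set.mem_ofPred_eq, Set.mem_insert_iff,
      Set.mem_singleton_iff] at h ⊢
    simpa only [← Pi.smul_comp, ← Pi.neg_comp, hinj.eq_iff] using h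
  σ_image i a := by
    ext v
    have hmem := R.σ_mem_iff (φ₀.symm i) (φ₁.symm a) (v ∘ φ₀)
    rw [← CartanScheme.transport_σ_comp] at hmem
    simp only [Set.mem_image, Set.mem_ofPred_eq]
    have hρ : φ₁.symm ((C.transport φ₀ φ₁).ρ i a) = C.ρ (φ₀.symm i) (φ₁.symm a) := by
      simp [CartanScheme.transport]
    rw [hρ, ← hmem]
    constructor
    · rintro ⟨w, hw, rfl⟩
      rwa [CartanScheme.σ_σ]
    · exact fun h => ⟨_, h, CartanScheme.σ_σ _ _ _ _⟩
  iterate_ρ i j a hij hfin := by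
    have hinj := φ₀.surjective.injective_comp_right (γ := ℤ)
    have himg : rankTwoPart (R.roots (φ₁.symm a)) (φ₀.symm i) (φ₀.symm j) =
        (fun v : I' → ℤ => v ∘ φ₀) '' rankTwoPart {v | v ∘ φ₀ ∈ R.roots (φ₁.symm a)} i j := by
      ext w
      simp only [rankTwoPart, Set.mem_image, Set.mem_ofPred_eq, ← simpleRoot_comp_equiv]
      constructor
      · rintro ⟨hw, p, q, rfl⟩
        exact ⟨p • simpleRoot i + q • simpleRoot j, ⟨hw, p, q, rfl⟩, rfl⟩
      · rintro ⟨v, ⟨hv, p, q, rfl⟩, rfl⟩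
        exact ⟨hv, p, q, rfl⟩
    have h := R.iterate_ρ (φ₀.symm i) (φ₀.symm j) (φ₁.symm a) (φ₀.symm.injective.ne hij)
      (himg ▸ hfin.image _)
    rw [himg, Set.ncard_image_of_injective _ hinj] at h
    have hsc : Function.Semiconj φ₁ (C.ρ (φ₀.symm i) ∘ C.ρ (φ₀.symm j))
        ((C.transport φ₀ φ₁).ρ i ∘ (C.transport φ₀ φ₁).ρ j) := fun x => by
      simp [CartanScheme.transport]
    have h2 := (hsc.iterate_right (rankTwoPart {v | v ∘ φ₀ ∈ R.roots (φ₁.symm a)} i j).ncard)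
      (φ₁.symm a)
    rw [h, Equiv.apply_symm_apply] at h2
    exact h2.symm

theorem SchemeRootSystem.equivalent_transport {C : CartanScheme I A} (R : SchemeRootSystem C)
    (φ₀ : I ≃ I') (φ₁ : A ≃ A') : R.Equivalent (R.transport φ₀ φ₁) := by
  refine ⟨φ₀, φ₁, fun i a => by simp [CartanScheme.transport],
    fun a i j => by simp [CartanScheme.transport], fun a => ?_⟩
  ext v
  rw [LinearEquiv.image_eq_preimage_symm]
  simp only [SchemeRootSystem.transport, Equiv.symm_apply_apply, Set.mem_ofPred_eq,
    Set.mem_preimage]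
  rfl

/-- Transport of a finite root system along bijections of the index and object sets. -/
def FiniteRootSystem.transport (R : FiniteRootSystem I A) (φ₀ : I ≃ I') (φ₁ : A ≃ A') :
    FiniteRootSystem I' A' where
  scheme := R.scheme.transport φ₀ φ₁
  rootSystem := R.rootSystem.transport φ₀ φ₁
  isFinite a := (R.isFinite (φ₁.symm a)).preimage
    (φ₀.surjective.injective_comp_right (γ := ℤ)).injOn

/-- Equivalence of finite root systems with the same index and object sets. -/
def FiniteRootSystem.setoid (I A : Type*) [Fintype I] [DecidableEq I] :
    Setoid (FiniteRootSystem I A) where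
  r R R' := R.rootSystem.Equivalent R'.rootSystem
  iseqv := ⟨fun R => .refl R.rootSystem, fun h => h.symm, fun h h' => h.trans h'⟩

end Transport

/-- First clause: on given index and object sets with `r` and `n` elements there are, as literal
data, only finitely many finite root systems. Second clause: there is a finite list such that each
finite root system of rank `r` with `n` objects is equivalent to exactly one entry of the list. -/
theorem mainTheorem9 (r n : ℕ) :
    (∀ (I : Type u) (A : Type v) [Fintype I] [DecidableEq I] [Fintype A],
      Fintype.card I = r → Fintype.card A = n → Finite (FiniteRootSystem I A)) ∧
    ∃ L : Set (FiniteRootSystem (Fin r) (Fin n)), L.Finite ∧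
      ∀ (I : Type u) (A : Type v) [Fintype I] [DecidableEq I] [Fintype A],
        Fintype.card I = r → Fintype.card A = n →
        ∀ R : FiniteRootSystem I A,
          ∃! S : FiniteRootSystem (Fin r) (Fin n),
            S ∈ L ∧ R.rootSystem.Equivalent S.rootSystem := by
  refine ⟨fun I A _ _ _ _ _ => FiniteRootSystem.finite_of_fintype, ?_⟩
  have hfin : Finite (FiniteRootSystem (Fin r) (Fin n)) := FiniteRootSystem.finite_of_fintype
  let s := FiniteRootSystem.setoid (Fin r) (Fin n)
  refine ⟨Set.range (Quotient.out (s := s)), Set.toFinite _, ?_⟩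
  intro I A _ _ _ hI hA R
  let T := R.transport (Fintype.equivFinOfCardEq hI) (Fintype.equivFinOfCardEq hA)
  have hT : R.rootSystem.Equivalent T.rootSystem := R.rootSystem.equivalent_transport _ _
  refine ⟨(Quotient.mk s T).out, ⟨⟨_, rfl⟩, hT.trans (Quotient.mk_out (s := s) T).symm⟩, ?_⟩
  rintro _ ⟨⟨q, rfl⟩, hq⟩
  have h : Quotient.mk s T = q := by
    rw [← Quotient.out_eq q]
    exact Quotient.sound (hT.symm.trans hq)
  rw [h]
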